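/- Lemma 5.3. For a unit vector $u\in S^{d-1}\subset\mathbb R^d$ let $G^{u^\perp}(d-1,j)$ denote the Grassmannian of $j$-dimensional linear subspaces of the hyperplane $u^\perp$, and let $\nu^{d-1}_j$ denote its Haar probability measure, i.e. the unique Borel probability measure on it that is invariant under the orthogonal group $O(u^\perp)$. Equip $\bigwedge_j\mathbb R^d$ with its usual scalar product, for which $\langle v_1\wedge\cdots\wedge v_j,\,w_1\wedge\cdots\wedge w_j\rangle=\det(\langle v_a,w_b\rangle)_{a,b}$. A $j$-dimensional linear subspace with orthonormal basis $b_1,\ldots,b_j$ is identified with the associated unit simple multivector $b_1\wedge\cdots\wedge b_j\in\bigwedge_j\mathbb R^d$, which is determined up to sign. Let $u_1,\ldots,u_k\in S^{d-1}$ and let $1\le j_1,\ldots,j_k\le d-1$ be integers with $j_1+\cdots+j_k=d$. Then there exists a continuous function $$\Phi_{u_1,\ldots,u_k}:\ G^{u_1^\perp}(d-1,j_1)\times\cdots\times G^{u_k^\perp}(d-1,j_k)\to\mathbb R$$ such that for all $A_1\in G^{u_1^\perp}(d-1,j_1),\ldots,A_k\in G^{u_k^\perp}(d-1,j_k)$,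 $$\int\cdots\int\Phi_{u_1,\ldots,u_k}(U_1,\ldots,U_k)\,\langle U_1,A_1\rangle^2\cdots\langle U_k,A_k\rangle^2\,dU_1\cdots dU_k=\|A_1\wedge\cdots\wedge A_k\|^2,$$ where $dU_i=\nu^{d-1}_{j_i}(dU_i)$ denotes integration over $U_i\in G^{u_i^\perp}(d-1,j_i)$. -/

import Mathlib

open MeasureTheory

noncomputable section

namespace FlagGrassmann

/-! ### Multivectors -/

section Multivectors

variable {E : Type*} [NormedAddCommGroup E] [InnerProductSpace ℝ E]

/-- The exterior product `ξ₀ ∧ ξ₁ ∧ ⋯ ∧ ξₖ₋₁` (in this order) of multivectors of degrees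
`j 0, …, j (k - 1)`, as a multivector of degree `∑ i, j i`. The product is the one of the
exterior algebra; the empty product is `1 ∈ ⋀⁰ E`. -/
def wedge {k : ℕ} {j : Fin k → ℕ} (ξ : ∀ i, ⋀[ℝ]^(j i) E) : ⋀[ℝ]^(∑ i, j i) E :=
  ⟨(List.ofFn fun i => (ξ i : ExteriorAlgebra ℝ E)).prod, by
    have h := SetLike.list_prod_ofFn_mem_graded (A := fun n : ℕ => ⋀[ℝ]^n E) j
      (fun i => (ξ i : ExteriorAlgebra ℝ E)) (fun i => (ξ i).2)
    rwa [List.sum_ofFn] at h⟩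

/-- One of the two unit simple `n`-vectors associated with an `n`-dimensional linear subspace `V`,
namely `b₁ ∧ ⋯ ∧ bₙ` for some orthonormal basis `b₁, …, bₙ` of `V`. -/
def unitMultivector {n : ℕ} (V : Submodule ℝ E) [FiniteDimensional ℝ V]
    (hV : Module.finrank ℝ V = n) : ⋀[ℝ]^n E :=
  exteriorPower.ιMulti ℝ n fun i =>
    ((((stdOrthonormalBasis ℝ V).reindex (finCongr hV)) i : V) : E)

/-- Up to sign, the associated unit simple multivector does not depend on the orthonormal basis. -/
theorem unitMultivector_eq_or_eq_neg [FiniteDimensional ℝ E] {n : ℕ} (V : Submodule ℝ E)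
    (hV : Module.finrank ℝ V = n) (b : OrthonormalBasis (Fin n) ℝ V) :
    unitMultivector V hV = exteriorPower.ιMulti ℝ n (fun i => (b i : E)) ∨
      unitMultivector V hV = -exteriorPower.ιMulti ℝ n (fun i => (b i : E)) := by
  have hnorm : ∀ c : OrthonormalBasis (Fin n) ℝ V,
      ‖exteriorPower.ιMulti ℝ n (fun i => (c i : E))‖ = 1 := by
    intro c
    have h : inner ℝ (exteriorPower.ιMulti ℝ n (fun i => (c i : E)))
        (exteriorPower.ιMulti ℝ n (fun i => (c i : E))) = 1 := by
      rw [exteriorPower.inner_ιMulti_self, Matrix.gram_eq_one_iff_orthonormal.mpr, Matrix.det_one]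
      exact c.orthonormal.comp_linearIsometry V.subtypeₗᵢ
    rw [real_inner_self_eq_norm_sq] at h
    nlinarith [norm_nonneg (exteriorPower.ιMulti ℝ n (fun i => (c i : E)))]
  set c := (stdOrthonormalBasis ℝ V).reindex (finCongr hV) with hc
  have hinner : inner ℝ (exteriorPower.ιMulti ℝ n (fun i => (c i : E)))
      (exteriorPower.ιMulti ℝ n (fun i => (b i : E))) = b.toBasis.det c := by
    rw [exteriorPower.inner_ιMulti_ιMulti, Module.Basis.det_apply]
    congr 1
    ext i l
    simp [Module.Basis.toMatrix_apply, OrthonormalBasis.repr_apply_apply, real_inner_comm]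
  have hdet := b.det_to_matrix_orthonormalBasis_real c
  rcases hdet with h | h
  · left
    exact (inner_eq_one_iff_of_norm_eq_one (𝕜 := ℝ) (hnorm c) (hnorm b)).1 (hinner.trans h)
  · right
    refine (inner_eq_one_iff_of_norm_eq_one (𝕜 := ℝ) (hnorm c)
      (by rw [norm_neg]; exact hnorm b)).1 ?_
    rw [inner_neg_right, hinner, h, neg_neg]

end Multivectors

/-! ### Grassmannians and their invariant probability measures -/

/-- The Grassmannian of `j`-dimensional linear subspaces of `E`. -/
def Grassmannian (E : Type*) [NormedAddCommGroup E] [InnerProductSpace ℝ E] (j : ℕ) : Type _ :=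
  {U : Submodule ℝ E // Module.finrank ℝ U = j}

section Grassmannian

variable {E : Type*} [NormedAddCommGroup E] [InnerProductSpace ℝ E] [FiniteDimensional ℝ E]
  {j : ℕ}

/-- The orthogonal projection onto an element of the Grassmannian, as an operator on `E`. -/
def Grassmannian.proj (U : Grassmannian E j) : E →L[ℝ] E := U.1.starProjection

/-- The usual topology of the Grassmannian: a subspace is identified with the orthogonal projection
onto it, and operators carry the norm topology. -/
instance : TopologicalSpace (Grassmannian E j) :=
  TopologicalSpace.induced Grassmannian.proj inferInstance

/-- The Borel `σ`-algebra of the Grassmannian. -/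
instance : MeasurableSpace (Grassmannian E j) := borel _

instance : BorelSpace (Grassmannian E j) := ⟨rfl⟩

variable [CompleteSpace E]

variable (E) in
/-- The orthogonal group `O(E)`, with the topology given by the operator norm. -/
abbrev OrthogonalGroup : Type _ := unitary (E →L[ℝ] E)

instance : CompactSpace (OrthogonalGroup E) := by
  have : ProperSpace (E →L[ℝ] E) := FiniteDimensional.proper ℝ _
  have hK : IsCompact (unitary (E →L[ℝ] E) : Set (E →L[ℝ] E)) := by
    refine Metric.isCompact_of_isClosed_isBounded isClosed_unitary ?_
    refine (Metric.isBounded_closedBall (x := (0 : E →L[ℝ] E)) (r := 1)).subset fun u hu => ?_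
    rw [mem_closedBall_zero_iff]
    exact ContinuousLinearMap.opNorm_le_bound _ zero_le_one fun x => by
      rw [ContinuousLinearMap.norm_map_of_mem_unitary hu, one_mul]
  exact isCompact_iff_compactSpace.1 hK

variable (E) in
/-- The Haar probability measure on the orthogonal group `O(E)`. -/
def haarOrthogonal : Measure (OrthogonalGroup E) := Measure.haarMeasure ⊤

/-- The image `Q W` of a `j`-dimensional subspace `W` under an orthogonal map `Q`. -/
def Grassmannian.rotate (Q : OrthogonalGroup E) (W : Grassmannian E j) : Grassmannian E j :=
  ⟨W.1.map ((Unitary.linearIsometryEquiv Q).toLinearEquiv : E →ₗ[ℝ] E), by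
    rw [LinearEquiv.finrank_map_eq]; exact W.2⟩

open Classical in
variable (E j) in
/-- The invariant (Haar) probability measure on the Grassmannian of `j`-dimensional subspaces of
`E`: the distribution of `Q W`, where `W` is some fixed `j`-dimensional subspace and `Q` is
distributed according to the Haar probability measure of `O(E)`. (It is the zero measure in the
case where there is no `j`-dimensional subspace at all.) -/
def haarGrassmannian : Measure (Grassmannian E j) :=
  if h : Nonempty (Grassmannian E j) then
    (haarOrthogonal E).map fun Q => Grassmannian.rotate Q h.some
  else 0

theorem Grassmannian.proj_rotate (Q : OrthogonalGroup E) (W : Grassmannian E j) :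
    (rotate Q W).proj = (Q : E →L[ℝ] E) * W.proj * (star Q : OrthogonalGroup E) := by
  ext x
  exact Submodule.starProjection_map_apply (Unitary.linearIsometryEquiv Q) W.1 x

theorem Grassmannian.continuous_rotate_left (W : Grassmannian E j) :
    Continuous fun Q : OrthogonalGroup E => rotate Q W := by
  refine continuous_induced_rng.2 ?_
  have h : (proj ∘ fun Q : OrthogonalGroup E => rotate Q W) =
      fun Q : OrthogonalGroup E =>
        (Q : E →L[ℝ] E) * W.proj * (star (Q : E →L[ℝ] E)) := by
    ext1 Q
    simpa using proj_rotate Q W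
  rw [h]
  fun_prop

theorem Grassmannian.continuous_rotate_right (Q : OrthogonalGroup E) :
    Continuous fun W : Grassmannian E j => rotate Q W := by
  refine continuous_induced_rng.2 ?_
  have h : (proj ∘ fun W : Grassmannian E j => rotate Q W) =
      fun W => (Q : E →L[ℝ] E) * W.proj * (star Q : OrthogonalGroup E) := by
    ext1 W
    exact proj_rotate Q W
  rw [h]
  have hp : Continuous (proj : Grassmannian E j → E →L[ℝ] E) := continuous_induced_dom
  fun_prop

set_option linter.unusedSectionVars false in
theorem Grassmannian.rotate_mul (Q R : OrthogonalGroup E) (W : Grassmannian E j) :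
    rotate (Q * R) W = rotate Q (rotate R W) := by
  apply Subtype.ext
  ext x
  simp [rotate]
  rfl

instance : IsProbabilityMeasure (haarOrthogonal E) :=
  ⟨by simpa [haarOrthogonal] using Measure.haarMeasure_self (K₀ := (⊤ :
    TopologicalSpace.PositiveCompacts (OrthogonalGroup E)))⟩

instance [h : Nonempty (Grassmannian E j)] : IsProbabilityMeasure (haarGrassmannian E j) := by
  rw [haarGrassmannian, dif_pos h]
  exact Measure.isProbabilityMeasure_map
    (Grassmannian.continuous_rotate_left _).measurable.aemeasurable

/-- `haarGrassmannian` is invariant under the orthogonal group. -/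
theorem map_rotate_haarGrassmannian (Q : OrthogonalGroup E) :
    (haarGrassmannian E j).map (Grassmannian.rotate Q) = haarGrassmannian E j := by
  by_cases h : Nonempty (Grassmannian E j)
  · rw [haarGrassmannian, dif_pos h, Measure.map_map
      (Grassmannian.continuous_rotate_right Q).measurable
      (Grassmannian.continuous_rotate_left _).measurable]
    have h2 : (Grassmannian.rotate Q ∘ fun R => Grassmannian.rotate R h.some) =
        (fun R => Grassmannian.rotate R h.some) ∘ fun R => Q * R := by
      ext1 R
      exact (Grassmannian.rotate_mul Q R _).symm
    rw [h2, ← Measure.map_map (Grassmannian.continuous_rotate_left _).measurable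
      (continuous_const_mul Q).measurable, haarOrthogonal, map_mul_left_eq_self]
  · rw [haarGrassmannian, dif_neg h, Measure.map_zero]

end Grassmannian

/-! ### Subspaces of a hyperplane `u^⊥` in `ℝᵈ` -/

section Hyperplane

variable {d : ℕ}

/-- `G^{u^⊥}(d - 1, j)`: the Grassmannian of `j`-dimensional linear subspaces of the orthogonal
complement of a unit vector `u` of `ℝᵈ`. -/
abbrev GrassmannianPerp (u : Metric.sphere (0 : EuclideanSpace ℝ (Fin d)) 1) (j : ℕ) : Type :=
  Grassmannian (ℝ ∙ (u : EuclideanSpace ℝ (Fin d)))ᗮ j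

/-- The Haar probability measure `ν` on `G^{u^⊥}(d - 1, j)`, invariant under `O(u^⊥)`. -/
abbrev haarPerp (u : Metric.sphere (0 : EuclideanSpace ℝ (Fin d)) 1) (j : ℕ) :
    Measure (GrassmannianPerp u j) :=
  haarGrassmannian (ℝ ∙ (u : EuclideanSpace ℝ (Fin d)))ᗮ j

/-- An element of `G^{u^⊥}(d - 1, j)`, considered as one of the two associated unit simple
multivectors in `⋀ʲ ℝᵈ`. -/
def GrassmannianPerp.multivector {u : Metric.sphere (0 : EuclideanSpace ℝ (Fin d)) 1} {j : ℕ}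
    (U : GrassmannianPerp u j) : ⋀[ℝ]^j (EuclideanSpace ℝ (Fin d)) :=
  unitMultivector (U.1.map (ℝ ∙ (u : EuclideanSpace ℝ (Fin d)))ᗮ.subtype)
    ((Submodule.finrank_map_subtype_eq _ U.1).trans U.2)

end Hyperplane

end FlagGrassmann

end

open FlagGrassmann

/-! The kernel `∏ i, ⟪U i, A i⟫ ^ 2` is the scalar product `⟪ψ U, ψ A⟫`, where `ψ A` is the tensor
product of all `A i ⊗ A i` in a finite-dimensional space (`inner_squareCoordinates`). As the wedge
is multilinear, its squared norm is a linear functional `⟪v, ψ A⟫`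
(`exists_inner_squareCoordinates_eq_norm_sq`). It remains to solve `∫ Φ U * ⟪ψ U, ψ A⟫ = ⟪v, ψ A⟫`
with `Φ U = ⟪ψ U, w⟫`. This is possible because the invariant measure charges every nonempty open
set: a vector killed by the second-moment operator of `ψ` is then orthogonal to every `ψ A`. The map
`ψ` is continuous because it is quadratic in each multivector, so the sign ambiguity cancels. -/

/-! ### Inverting a finite-rank integral operator. -/

section Reproducing

variable {X H : Type*} [TopologicalSpace X] [CompactSpace X] [MeasurableSpace X]
  [OpensMeasurableSpace X] [NormedAddCommGroup H] [InnerProductSpace ℝ H] [FiniteDimensional ℝ H]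

/-- Every linear functional composed with a continuous map `ψ` into a finite-dimensional inner
product space lies in the range of the integral operator with kernel `⟪ψ x, ψ a⟫`, provided that
the measure has full support. -/
theorem exists_continuous_integral_mul_inner_eq (μ : Measure X) [IsFiniteMeasure μ]
    [μ.IsOpenPosMeasure] {ψ : X → H} (hψ : Continuous ψ) (v : H) :
    ∃ Φ : X → ℝ, Continuous Φ ∧ ∀ a, ∫ x, Φ x * inner ℝ (ψ x) (ψ a) ∂μ = inner ℝ v (ψ a) := by
  have hi : ∀ w : H, Integrable (fun x => inner ℝ (ψ x) w • ψ x) μ := fun w =>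
    Continuous.integrable_of_hasCompactSupport (by fun_prop) (HasCompactSupport.of_compactSpace _)
  -- The second-moment operator `∫ ψ ⊗ ψ dμ`.
  let T : H →ₗ[ℝ] H :=
    { toFun := fun w => ∫ x, inner ℝ (ψ x) w • ψ x ∂μ
      map_add' := fun w w' => by
        rw [← integral_add (hi w) (hi w')]
        simp only [inner_add_right, add_smul]
      map_smul' := fun c w => by
        rw [RingHom.id_apply, ← integral_smul]
        simp only [inner_smul_right, mul_smul] }
  have hT : ∀ w w', inner ℝ (T w) w' = ∫ x, inner ℝ (ψ x) w * inner ℝ (ψ x) w' ∂μ := by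
    intro w w'
    rw [real_inner_comm]
    refine (integral_inner (hi w) w').symm.trans (integral_congr_ae (.of_forall fun x => ?_))
    simp only [inner_smul_right, real_inner_comm]
  have hsymm : T.IsSymmetric := fun w w' => by
    rw [hT, ← real_inner_comm, hT]
    simp only [mul_comm]
  -- Here `⟪T n, n⟫` is the integral of `⟪ψ x, n⟫ ^ 2`. If it vanishes, the integrand is zero almost
  -- everywhere, hence everywhere by continuity and full support.
  have hker : ∀ n, T n = 0 → ∀ a, inner ℝ (ψ a) n = 0 := by
    intro n hn a
    have h0 := hT n n
    rw [hn, inner_zero_left] at h0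
    have hc : Continuous fun x => inner ℝ (ψ x) n * inner ℝ (ψ x) n := by fun_prop
    have h1 := (integral_eq_zero_iff_of_nonneg (fun x => mul_self_nonneg _)
      (hc.integrable_of_hasCompactSupport (HasCompactSupport.of_compactSpace _))).1 h0.symm
    have h2 := (hc.ae_eq_iff_eq μ continuous_const).1 h1
    exact mul_self_eq_zero.1 (congrFun h2 a)
  obtain ⟨w, hw⟩ : ∃ w, T w = (LinearMap.range T).starProjection v :=
    (LinearMap.range T).starProjection_apply_mem v
  refine ⟨fun x => inner ℝ (ψ x) w, by fun_prop, fun a => ?_⟩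
  -- The residual is orthogonal to the range of the symmetric operator `T`, hence lies in its kernel
  -- and is invisible to every `ψ a`.
  have hn : v - T w ∈ LinearMap.ker T := by
    rw [← hsymm.orthogonal_range, hw]
    exact Submodule.sub_starProjection_mem_orthogonal v
  have h := hker _ hn a
  rw [inner_sub_right, sub_eq_zero, real_inner_comm, real_inner_comm (T w), hT] at h
  exact h.symm

end Reproducing

/-! ### Tensor squares and multilinear maps. -/

section SquareCoordinates

variable {ι : Type*} [Fintype ι] [DecidableEq ι] {V κ : ι → Type*}
  [∀ i, NormedAddCommGroup (V i)] [∀ i, InnerProductSpace ℝ (V i)]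
  [∀ i, Fintype (κ i)]

/-- The coordinates of the tensor product of all the `a i ⊗ a i` in the basis induced by
orthonormal bases `e i`. -/
noncomputable def squareCoordinates (e : ∀ i, OrthonormalBasis (κ i) ℝ (V i)) (a : ∀ i, V i) :
    EuclideanSpace ℝ (∀ i, κ i × κ i) :=
  WithLp.toLp 2 fun γ => ∏ i, (inner ℝ (e i (γ i).1) (a i) * inner ℝ (e i (γ i).2) (a i))

/-- Parseval in each factor, squared; the product of the resulting sums is then expanded. -/
theorem inner_squareCoordinates (e : ∀ i, OrthonormalBasis (κ i) ℝ (V i)) (a b : ∀ i, V i) :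
    inner ℝ (squareCoordinates e a) (squareCoordinates e b) = ∏ i, (inner ℝ (a i) (b i)) ^ 2 := by
  have h : ∀ i, (inner ℝ (a i) (b i)) ^ 2 =
      ∑ p : κ i × κ i, (inner ℝ (e i p.1) (a i) * inner ℝ (e i p.2) (a i)) *
        (inner ℝ (e i p.1) (b i) * inner ℝ (e i p.2) (b i)) := by
    intro i
    rw [← (e i).sum_inner_mul_inner, sq, Finset.sum_mul_sum, Fintype.sum_prod_type]
    refine Finset.sum_congr rfl fun p _ => Finset.sum_congr rfl fun q _ => ?_
    rw [real_inner_comm (e i p) (a i), real_inner_comm (e i q) (a i)]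
    ring
  simp only [h, Finset.prod_univ_sum, Fintype.piFinset_univ, PiLp.inner_apply]
  refine Finset.sum_congr rfl fun γ _ => ?_
  rw [Finset.prod_mul_distrib, RCLike.inner_apply, conj_trivial, mul_comm]
  rfl

/-- The squared norm of a multilinear map is linear in the square coordinates. -/
theorem exists_inner_squareCoordinates_eq_norm_sq {F : Type*} [NormedAddCommGroup F]
    [InnerProductSpace ℝ F] (e : ∀ i, OrthonormalBasis (κ i) ℝ (V i)) (m : MultilinearMap ℝ V F) :
    ∃ v, ∀ a, inner ℝ v (squareCoordinates e a) = ‖m a‖ ^ 2 := by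
  -- Coefficients of the double sum obtained by expanding `⟪m a, m a⟫` in the bases; `γ` encodes the
  -- pair of multi-indices.
  refine ⟨WithLp.toLp 2 fun γ =>
    inner ℝ (m fun i => e i (γ i).1) (m fun i => e i (γ i).2), fun a => ?_⟩
  have h : m a = ∑ β : ∀ i, κ i, (∏ i, inner ℝ (e i (β i)) (a i)) • m fun i => e i (β i) := by
    have h1 : a = fun i => ∑ p, inner ℝ (e i p) (a i) • e i p :=
      funext fun i => ((e i).sum_repr' _).symm
    conv_lhs => rw [h1, MultilinearMap.map_sum]
    simp only [MultilinearMap.map_smul_univ]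
  rw [← real_inner_self_eq_norm_sq, h, sum_inner, PiLp.inner_apply,
    ← (Equiv.arrowProdEquivProdArrow _ κ κ).symm.sum_comp, Fintype.sum_prod_type]
  refine Finset.sum_congr rfl fun α _ => ?_
  rw [inner_sum]
  refine Finset.sum_congr rfl fun β _ => ?_
  rw [real_inner_smul_left, real_inner_smul_right, RCLike.inner_apply, conj_trivial, ← mul_assoc,
    ← Finset.prod_mul_distrib]
  rfl

end SquareCoordinates

namespace FlagGrassmann

/-! ### Compactness of the Grassmannian and full support of its measure. -/

section Grassmannian

variable {E : Type*} [NormedAddCommGroup E] [InnerProductSpace ℝ E] [FiniteDimensional ℝ E]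
  {j : ℕ}

theorem Grassmannian.continuous_proj : Continuous (proj : Grassmannian E j → E →L[ℝ] E) :=
  continuous_induced_dom

/-- Makes open sets of a finite product of Grassmannians measurable for the product `σ`-algebra. -/
instance : SecondCountableTopology (Grassmannian E j) :=
  have : ProperSpace (E →L[ℝ] E) := FiniteDimensional.proper ℝ _
  (Topology.IsInducing.mk rfl : Topology.IsInducing
    (Grassmannian.proj : Grassmannian E j → E →L[ℝ] E)).secondCountableTopology

variable [CompleteSpace E]

/-- The orthogonal group acts transitively on the Grassmannian. -/
theorem Grassmannian.rotate_left_surjective (W : Grassmannian E j) :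
    Function.Surjective fun Q : OrthogonalGroup E => rotate Q W := by
  intro V
  let e : W.1 ≃ₗᵢ[ℝ] V.1 := (stdOrthonormalBasis ℝ W.1).equiv (stdOrthonormalBasis ℝ V.1)
    (finCongr (W.2.trans V.2.symm))
  -- An isometry from `W` onto `V` extends to all of `E`, and is then orthogonal because `E` is
  -- finite-dimensional.
  let L : E →ₗᵢ[ℝ] E := (V.1.subtypeₗᵢ.comp e.toLinearIsometry).extend
  have hL : ∀ x : W.1, L x = e x := LinearIsometry.extend_apply _
  refine ⟨Unitary.linearIsometryEquiv.symm (L.toLinearIsometryEquiv rfl), Subtype.ext ?_⟩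
  refine Submodule.eq_of_le_of_finrank_eq ?_ ?_
  · rintro _ ⟨x, hx, rfl⟩
    have : L x = e ⟨x, hx⟩ := hL ⟨x, hx⟩
    change L x ∈ V.1
    rw [this]
    exact (e ⟨x, hx⟩).2
  · exact (rotate _ W).2.trans V.2.symm

instance : CompactSpace (Grassmannian E j) := by
  rcases isEmpty_or_nonempty (Grassmannian E j) with h | ⟨⟨W⟩⟩
  · infer_instance
  · exact (Grassmannian.rotate_left_surjective W).compactSpace
      (Grassmannian.continuous_rotate_left W)

instance : IsFiniteMeasure (haarGrassmannian E j) := by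
  rcases isEmpty_or_nonempty (Grassmannian E j) with h | h
  · rw [haarGrassmannian, dif_neg (not_nonempty_iff.2 h)]
    infer_instance
  · infer_instance

/-- The orbit map pulls a nonempty open set back to an open set, nonempty by transitivity, which
Haar measure charges. -/
instance : (haarGrassmannian E j).IsOpenPosMeasure := by
  refine ⟨fun O hO hne => ?_⟩
  obtain ⟨V, hV⟩ := hne
  have h : Nonempty (Grassmannian E j) := ⟨V⟩
  have hc := Grassmannian.continuous_rotate_left (E := E) h.some
  rw [haarGrassmannian, dif_pos h, Measure.map_apply hc.measurable hO.measurableSet]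
  obtain ⟨Q, hQ⟩ := Grassmannian.rotate_left_surjective h.some V
  have : (haarOrthogonal E).IsOpenPosMeasure := by
    unfold haarOrthogonal
    infer_instance
  refine (hO.preimage hc).measure_ne_zero _ ⟨Q, (congrArg (· ∈ O) hQ).mpr hV⟩

end Grassmannian

/-! ### Continuity of quadratic functions of the unit multivector. -/

section Multivectors

variable {E : Type*} [NormedAddCommGroup E] [InnerProductSpace ℝ E]

/-- The exterior product of multivectors as a multilinear map. -/
def wedgeMultilinear (k : ℕ) (j : Fin k → ℕ) :
    MultilinearMap ℝ (fun i => ⋀[ℝ]^(j i) E) (⋀[ℝ]^(∑ i, j i) E) :=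
  ((MultilinearMap.mkPiAlgebraFin ℝ k (ExteriorAlgebra ℝ E)).compLinearMap
    fun i => (⋀[ℝ]^(j i) E).subtype).codRestrict _ fun ξ => by
      rw [MultilinearMap.compLinearMap_apply, MultilinearMap.mkPiAlgebraFin_apply]
      exact (wedge ξ).2

theorem wedgeMultilinear_apply {k : ℕ} {j : Fin k → ℕ} (ξ : ∀ i, ⋀[ℝ]^(j i) E) :
    wedgeMultilinear k j ξ = wedge ξ := by
  apply Subtype.ext
  simp [wedgeMultilinear, wedge, MultilinearMap.mkPiAlgebraFin_apply]

variable [FiniteDimensional ℝ E]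

/-- Both factors are determinants against the same orthonormal basis `c` of `V`. Multiplying the
matrices produces `∑ i, c i ⊗ c i`, the projection onto `V`, so the choice of `c` and of sign
disappears. -/
theorem inner_ιMulti_mul_inner_ιMulti_unitMultivector {n : ℕ} (V : Submodule ℝ E)
    (hV : Module.finrank ℝ V = n) (x y : Fin n → E) :
    inner ℝ (exteriorPower.ιMulti ℝ n x) (unitMultivector V hV) *
        inner ℝ (exteriorPower.ιMulti ℝ n y) (unitMultivector V hV) =
      (Matrix.of fun a b => inner ℝ (x a) (V.starProjection (y b))).det := by
  set c := (stdOrthonormalBasis ℝ V).reindex (finCongr hV) with hc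
  rw [unitMultivector, exteriorPower.inner_ιMulti_ιMulti, exteriorPower.inner_ιMulti_ιMulti,
    ← Matrix.det_transpose (Matrix.of fun a b => inner ℝ (x b) _), ← Matrix.det_mul]
  congr 1
  ext a b
  have h : V.starProjection (y b) = ∑ i, inner ℝ (c i : E) (y b) • (c i : E) := by
    rw [Submodule.starProjection_apply, c.orthogonalProjectionOnto_apply_eq_sum]
    simp
  rw [Matrix.of_apply, h, inner_sum, Matrix.mul_apply]
  refine Finset.sum_congr rfl fun i _ => ?_
  rw [inner_smul_right, mul_comm, Matrix.transpose_apply, Matrix.of_apply, Matrix.of_apply,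
    real_inner_comm (y b)]

end Multivectors

section Hyperplane

variable {d : ℕ} {u : Metric.sphere (0 : EuclideanSpace ℝ (Fin d)) 1} {j : ℕ}

/-- The topology comes from projections inside `u^⊥`; projecting from `ℝᵈ` onto `U` factors through
`u^⊥`. -/
theorem GrassmannianPerp.continuous_starProjection_map (x : EuclideanSpace ℝ (Fin d)) :
    Continuous fun U : GrassmannianPerp u j =>
      (U.1.map (ℝ ∙ (u : EuclideanSpace ℝ (Fin d)))ᗮ.subtype).starProjection x := by
  set K := (ℝ ∙ (u : EuclideanSpace ℝ (Fin d)))ᗮ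
  have h : (fun U : GrassmannianPerp u j => (U.1.map K.subtype).starProjection x) =
      fun U => (U.proj (K.orthogonalProjectionOnto x) : EuclideanSpace ℝ (Fin d)) := by
    ext1 U
    refine Submodule.eq_starProjection_of_mem_of_inner_eq_zero
      (Submodule.mem_map_of_mem (f := K.subtype) (U.1.starProjection_apply_mem _)) ?_
    rintro _ ⟨y, hy, rfl⟩
    have h1 : inner ℝ (x - K.orthogonalProjectionOnto x) (y : EuclideanSpace ℝ (Fin d)) = 0 :=
      Submodule.starProjection_inner_eq_zero x y y.2
    have h2 : inner ℝ (K.orthogonalProjectionOnto x - U.1.starProjection (K.orthogonalProjectionOnto x))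
      y = 0 := Submodule.starProjection_inner_eq_zero _ y hy
    rw [Submodule.coe_inner, Submodule.coe_sub, inner_sub_left] at h2
    rw [inner_sub_left] at h1 ⊢
    change inner ℝ x (y : EuclideanSpace ℝ (Fin d)) - inner ℝ ((U.1.starProjection (K.orthogonalProjectionOnto x) : K) :
      EuclideanSpace ℝ (Fin d)) (y : EuclideanSpace ℝ (Fin d)) = 0
    linarith
  rw [h]
  have hp := Grassmannian.continuous_proj (E := K) (j := j)
  fun_prop

/-- Although `multivector` itself is determined only up to sign, its quadratic functions are
continuous. -/
theorem GrassmannianPerp.continuous_inner_mul_inner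
    (ξ η : ⋀[ℝ]^j (EuclideanSpace ℝ (Fin d))) :
    Continuous fun U : GrassmannianPerp u j =>
      inner ℝ ξ U.multivector * inner ℝ η U.multivector := by
  -- By bilinearity it suffices to treat simple multivectors, where the product is a determinant in
  -- the projection.
  have hξ : ξ ∈ Submodule.span ℝ (Set.range
      (exteriorPower.ιMulti ℝ j (M := EuclideanSpace ℝ (Fin d)))) := by
    rw [exteriorPower.ιMulti_span]; trivial
  have hη : η ∈ Submodule.span ℝ (Set.range
      (exteriorPower.ιMulti ℝ j (M := EuclideanSpace ℝ (Fin d)))) := by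
    rw [exteriorPower.ιMulti_span]; trivial
  induction hξ, hη using Submodule.span_induction₂ with
  | mem_mem ξ η hξ hη =>
    obtain ⟨x, rfl⟩ := hξ
    obtain ⟨y, rfl⟩ := hη
    simp only [multivector, inner_ιMulti_mul_inner_ιMulti_unitMultivector]
    refine Continuous.matrix_det (continuous_matrix fun a b => ?_)
    exact continuous_const.inner (continuous_starProjection_map (y b))
  | zero_left η _ => simpa using continuous_const
  | zero_right ξ _ => simpa using continuous_const
  | add_left ξ ξ' η _ _ _ h h' =>
    simp only [inner_add_left, add_mul]
    exact h.add h'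
  | add_right ξ η η' _ _ _ h h' =>
    simp only [inner_add_left, mul_add]
    exact h.add h'
  | smul_left c ξ η _ _ h =>
    simp only [inner_smul_left, mul_assoc]
    exact continuous_const.mul h
  | smul_right c ξ η _ _ h =>
    simp only [inner_smul_left, mul_left_comm _ ((starRingEnd ℝ) c)]
    exact continuous_const.mul h

end Hyperplane

end FlagGrassmann

theorem lemma5p3 {d k : ℕ}
    (u : Fin k → Metric.sphere (0 : EuclideanSpace ℝ (Fin d)) 1)
    (j : Fin k → ℕ) (hj1 : ∀ i, 1 ≤ j i) (hjd : ∀ i, j i ≤ d - 1) (hsum : ∑ i, j i = d) :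
    ∃ Φ : (∀ i, FlagGrassmann.GrassmannianPerp (u i) (j i)) → ℝ,
      Continuous Φ ∧
      ∀ A : ∀ i, FlagGrassmann.GrassmannianPerp (u i) (j i),
        ∫ U, Φ U * ∏ i, (inner ℝ (FlagGrassmann.GrassmannianPerp.multivector (U i))
            (FlagGrassmann.GrassmannianPerp.multivector (A i))) ^ 2
          ∂(Measure.pi fun i => FlagGrassmann.haarPerp (u i) (j i)) =
        ‖FlagGrassmann.wedge fun i => FlagGrassmann.GrassmannianPerp.multivector (A i)‖ ^ 2 := by
  classical
  let e := fun i => stdOrthonormalBasis ℝ (⋀[ℝ]^(j i) (EuclideanSpace ℝ (Fin d)))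
  let ψ := fun A : ∀ i, GrassmannianPerp (u i) (j i) =>
    squareCoordinates e fun i => (A i).multivector
  have hψ : Continuous ψ := by
    refine (PiLp.continuous_toLp 2 _).comp (continuous_pi fun γ =>
      continuous_finsetProd _ fun i _ => ?_)
    exact (GrassmannianPerp.continuous_inner_mul_inner _ _).comp (continuous_apply i)
  obtain ⟨v, hv⟩ := exists_inner_squareCoordinates_eq_norm_sq e (wedgeMultilinear k j)
  obtain ⟨Φ, hΦ, h⟩ := exists_continuous_integral_mul_inner_eq
    (Measure.pi fun i => haarPerp (u i) (j i)) hψ v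
  refine ⟨Φ, hΦ, fun A => ?_⟩
  simpa only [ψ, inner_squareCoordinates, hv, wedgeMultilinear_apply] using h A
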